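/- Let $p$ be an odd prime, let $\varphi,\psi,\zeta_0,\dots,\zeta_{p-1}:\mathbb Z_p\to\mathbb Z_p$ be bijections, and let $I=[I_{x,y,z}]_{x,y,z\in\mathbb Z_p}$ be the binary identity tensor ($I_{x,y,z}=1$ if $x=y=z$, and $0$ otherwise). Let $P$ and $Q$ be the cyclic shifts of $p\times p\times p$ tensors by one step along the positive $x$- and $y$-axis: $P(T)_{x,y,z}=T_{x-1,y,z}$ and $Q(T)_{x,y,z}=T_{x,y-1,z}$. For $0\le i,j<p$ and $0\le k<p^2$ put $$a(i,j,k)=\zeta_{\lfloor k/p\rfloor}(k \bmod p)+\lfloor k/p\rfloor\,(\varphi(i)+\psi(j)) \bmod p,\qquad b(i,j,k)=\lfloor k/p\rfloor\,\varphi(i) \bmod p ,$$ and let $H_{2\text{-D}}$ be the binary $p^2\times p^2\times p^3$ tensor obtained by stacking the tensors $P^{a(i,j,k)}Q^{b(i,j,k)}(I)$ at the positions $(i,j,k)$. Its horizontal layers $\ell\in\{0,\dots,p^3-1\}$ are grouped into the $p$ horizontal block-layers $\{\ell:\lfloor \ell/p^2\rfloor=m\}$, $0\le m<p$. Let $w\ge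 1$, choose any $w$ distinct horizontal block-layers, and let $\widetilde H$ be the $wp^2\times p^4$ binary matrix whose rows are the horizontal layers in them, each read as a vector indexed by the positions of the $p^2\times p^2$ array. Let $\mathcal C$ be the 2-D classical QC-LDPC code with parity-check matrix $\widetilde H$. An entanglement-assisted CSS code with parameters $[[n,k;c]]$ given by the check operators $X^h$ and $Z^h$ ($h$ a row of $\widetilde H$) on the sender's $n$ qubits is a subspace of the space of $n+c$ qubits, of which the last $c$ belong to the receiver, such that * each $X^h$ and each $Z^h$ can be extended, by a product of Pauli operators $X$, respectively $Z$, on the receiver's qubits, so that the extended operators commute pairwise and the subspace is their joint $+1$ eigenspace; and * for $s=n-k-c\ge 0$ and some unitary $U$ on the sender's $n$ qubits, the subspace consists of the vectors $(U\otimes 1)\bigl(|\xi\rangle\otimes|0\rangle^{\otimes s}\otimes|\Phi\rangle^{\otimes c}\bigr)$, where $|\xi\rangle$ ranges over all vectors in the state space of $k$ qubits and $|\Phi\rangle=(|00\rangle+|11\rangle)/\sqrt2$ is an ebit shared by the sender and the receiver. **Theorem (2-D EA-QLDPC code from a single classical code).** There is an entanglement-assisted CSS code, given by the check operators $X^h$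 and $Z^h$ for the rows $h$ of $\widetilde H$, with parameters $$[[\,p^4,\ (p^2-1)(p^2-w+1);\ p^2+(w-1)(p^2-1)\,]].$$ It is a low-density parity-check code: every row of $\widetilde H$ has exactly $p^2$ ones (among $p^4$ entries) and every column has exactly $w$ ones. Moreover, the Tanner graph of $\mathcal C$ (the bipartite graph that joins a row of $\widetilde H$ to a column when their common entry is $1$) contains no cycle of length $4$. -/

import Mathlib

/-! ### The two-dimensional classical QC-LDPC code -/

/-- The identity tensor of size `p × p × p`, with binary entries. -/
def identityTensor (p : ℕ) (x y z : ZMod p) : ZMod 2 :=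
  if x = y ∧ y = z then 1 else 0

/-- The operator `P`: one cyclic shift along the positive `x`-axis. -/
def shiftX {p : ℕ} (T : ZMod p → ZMod p → ZMod p → ZMod 2) :
    ZMod p → ZMod p → ZMod p → ZMod 2 :=
  fun x y z => T (x - 1) y z

/-- The operator `Q`: one cyclic shift along the positive `y`-axis. -/
def shiftY {p : ℕ} (T : ZMod p → ZMod p → ZMod p → ZMod 2) :
    ZMod p → ZMod p → ZMod p → ZMod 2 :=
  fun x y z => T x (y - 1) z

/-- The map `η` on tile heights: `η(k) = ζ_{⌊k/p⌋}(k mod p)`; only `ζ 0, …, ζ (p - 1)` matter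
for `k < p ^ 2`. -/
def etaMap {p : ℕ} (ζ : ℕ → Equiv.Perm (ZMod p)) (k : ℕ) : ZMod p :=
  ζ (k / p) (k : ZMod p)

/-- The `X`-shift of the tile at position `(i, j, k)`:
`a(i, j, k) = η(k) + ⌊k/p⌋ (φ(i) + ψ(j)) mod p`. -/
def tileShiftX {p : ℕ} (φ ψ : Equiv.Perm (ZMod p)) (ζ : ℕ → Equiv.Perm (ZMod p))
    (i j k : ℕ) : ZMod p :=
  etaMap ζ k + ((k / p : ℕ) : ZMod p) * (φ (i : ZMod p) + ψ (j : ZMod p))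

/-- The `Y`-shift of the tile at position `(i, j, k)`: `b(i, j, k) = ⌊k/p⌋ φ(i) mod p`. -/
def tileShiftY {p : ℕ} (φ : Equiv.Perm (ZMod p)) (i k : ℕ) : ZMod p :=
  ((k / p : ℕ) : ZMod p) * φ (i : ZMod p)

/-- The permutation tensor `P^{a(i,j,k)} ∘ Q^{b(i,j,k)} (I)` at position `(i, j, k)`. -/
def tile {p : ℕ} (φ ψ : Equiv.Perm (ZMod p)) (ζ : ℕ → Equiv.Perm (ZMod p)) (i j k : ℕ) :
    ZMod p → ZMod p → ZMod p → ZMod 2 :=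
  shiftX^[(tileShiftX φ ψ ζ i j k).val] (shiftY^[(tileShiftY φ i k).val] (identityTensor p))

/-- The parity-check tensor: the stack of the `p × p × p²` tiles, each of size `p × p × p`. The
entry with global coordinates `(x, y, l)` lies in the tile `(⌊x/p⌋, ⌊y/p⌋, ⌊l/p⌋)`, at the local
position `(x mod p, y mod p, l mod p)`. -/
def parityCheckTensor {p : ℕ} (φ ψ : Equiv.Perm (ZMod p)) (ζ : ℕ → Equiv.Perm (ZMod p))
    (x y : Fin (p ^ 2)) (l : Fin (p ^ 3)) : ZMod 2 :=
  tile φ ψ ζ (x.val / p) (y.val / p) (l.val / p)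
    (x.val : ZMod p) (y.val : ZMod p) (l.val : ZMod p)

/-- The horizontal layers lying in the horizontal block-layers of `W`; the layer `l` belongs to
the horizontal block-layer `⌊l/p²⌋`. -/
abbrev SelectedLayer {p : ℕ} (W : Finset (Fin p)) : Type :=
  {l : Fin (p ^ 3) // ∃ m ∈ W, l.val / p ^ 2 = m.val}

/-- The parity-check tensor restricted to the horizontal block-layers of `W`, unfolded into a
matrix: one row for every selected horizontal layer and one column for every position of the
`p² × p²` array. -/
def parityCheckMatrix {p : ℕ} (φ ψ : Equiv.Perm (ZMod p)) (ζ : ℕ → Equiv.Perm (ZMod p))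
    (W : Finset (Fin p)) :
    Matrix (SelectedLayer W) (Fin (p ^ 2) × Fin (p ^ 2)) (ZMod 2) :=
  fun l q => parityCheckTensor φ ψ ζ q.1 q.2 l.val

/-- The Tanner graph of a binary parity-check matrix: check nodes are the rows, variable nodes
are the columns, and a row is joined to a column when the corresponding entry is nonzero. -/
def tannerGraph {R A : Type*} (H : Matrix R A (ZMod 2)) : SimpleGraph (R ⊕ A) :=
  SimpleGraph.fromRel fun u v => ∃ r a, u = Sum.inl r ∧ v = Sum.inr a ∧ H r a ≠ 0

/-- Every row has exactly `rowWeight` and every column exactly `colWeight` nonzero entries. -/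
def HasWeights {R A : Type*} (H : Matrix R A (ZMod 2)) (rowWeight colWeight : ℕ) : Prop :=
  (∀ r, {a | H r a ≠ 0}.ncard = rowWeight) ∧ ∀ a, {r | H r a ≠ 0}.ncard = colWeight

/-! ### Entanglement-assisted quantum codes -/

/-- The Hilbert space of a register of qubits indexed by `ι`: amplitudes with respect to the
computational basis `|v⟩`, where `v` runs through the bit strings `ι → ZMod 2`. -/
abbrev QState (ι : Type*) : Type _ := EuclideanSpace ℂ (ι → ZMod 2)

/-- The Pauli operator `X^a = ⨂ i, X^{a i}`, that is `|v⟩ ↦ |v + a⟩`. -/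
noncomputable def pauliX {ι : Type*} (a : ι → ZMod 2) (ψ : QState ι) : QState ι :=
  WithLp.toLp 2 fun v => ψ (v - a)

/-- The Pauli operator `Z^b = ⨂ i, Z^{b i}`, that is `|v⟩ ↦ (-1)^{b · v} |v⟩`. -/
noncomputable def pauliZ {ι : Type*} [Fintype ι] (b : ι → ZMod 2) (ψ : QState ι) : QState ι :=
  WithLp.toLp 2 fun v => (-1 : ℂ) ^ (b ⬝ᵥ v).val * ψ v

/-- The operator `U ⊗ 1` on the joint register of a sender and a receiver `β`. -/
noncomputable def onSender {σ α β : Type*} [Fintype σ] [DecidableEq σ] [Fintype α]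
    [DecidableEq α] (U : QState σ ≃ₗᵢ[ℂ] QState α) (Ψ : QState (σ ⊕ β)) : QState (α ⊕ β) :=
  WithLp.toLp 2 fun v =>
    U (WithLp.toLp 2 fun u => Ψ (Sum.elim u (v ∘ Sum.inr))) (v ∘ Sum.inl)

open Classical in
/-- The state `|ψ⟩ ⊗ |0⟩^{⊗ s} ⊗ |Φ⟩^{⊗ c}` before the encoding. The sender holds the `k`
information qubits, `s` ancillas and one half of each of the `c` ebits
`|Φ⟩ = (|00⟩ + |11⟩)/√2`; the receiver holds the other halves. -/
noncomputable def initialState {k : ℕ} (s c : ℕ) (ψ : QState (Fin k)) :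
    QState ((Fin k ⊕ (Fin s ⊕ Fin c)) ⊕ Fin c) :=
  WithLp.toLp 2 fun v =>
    ψ (fun t => v (Sum.inl (Sum.inl t))) *
      (if ∀ t, v (Sum.inl (Sum.inr (Sum.inl t))) = 0 then 1 else 0) *
      (if ∀ t, v (Sum.inl (Sum.inr (Sum.inr t))) = v (Sum.inr t)
        then ((Real.sqrt 2 : ℂ) ^ c)⁻¹ else 0)

/-- `C` is the entanglement-assisted CSS code with parameters `[[n, k; c]]` given by the sender's
check operators `X^h` (`h` a row of `HX`) and `Z^h` (`h` a row of `HZ`), which need not commute.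
The sender holds the `n` qubits indexed by `A`, the receiver `c` qubits. -/
structure IsEACSSCode {RX RZ A : Type*} [Fintype A] [DecidableEq A]
    (HX : Matrix RX A (ZMod 2)) (HZ : Matrix RZ A (ZMod 2)) (n k c : ℕ)
    (C : Submodule ℂ (QState (A ⊕ Fin c))) : Prop where
  /-- The code has length `n`. -/
  length_eq : Fintype.card A = n
  /-- The check operators extend, by Pauli operators on the receiver's qubits, to pairwise
  commuting operators on all qubits, and the code is their joint `+1` eigenspace. -/
  stabilizer : ∃ (BX : Matrix RX (Fin c) (ZMod 2)) (BZ : Matrix RZ (Fin c) (ZMod 2)),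
    (∀ r t, Sum.elim (HX r) (BX r) ⬝ᵥ Sum.elim (HZ t) (BZ t) = 0) ∧
    ∀ Ψ : QState (A ⊕ Fin c), Ψ ∈ C ↔
      (∀ r, pauliX (Sum.elim (HX r) (BX r)) Ψ = Ψ) ∧
      (∀ t, pauliZ (Sum.elim (HZ t) (BZ t)) Ψ = Ψ)
  /-- The code consists of the encodings of the states of `k` qubits, by a unitary acting on the
  sender's qubits only, with the help of ancillas and of `c` ebits. -/
  encoding : ∃ s : ℕ, k + s + c = n ∧ ∃ U : QState (Fin k ⊕ (Fin s ⊕ Fin c)) ≃ₗᵢ[ℂ] QState A,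
    ∀ Ψ : QState (A ⊕ Fin c), Ψ ∈ C ↔ ∃ ψ : QState (Fin k), onSender U (initialState s c ψ) = Ψ

/-!
Write a position of the array as a pair `(A, B)` of vectors in `V = ZMod p × ZMod p`, where `A`
collects `φ` and `ψ` of the tile indices and `B = (y, x - y)` the local coordinates, and write a
layer as a pair `(m, S)` of its block-layer `m` and the vector `S = (z, η(k)) ∈ V`. In these
coordinates (`layerCoordinates`, `positionCoordinates`) the parity-check matrix becomes the
incidence matrix `graphIncidence` between points of `V × V` and the graphs of the affine maps
`A ↦ S + m • A` (`parityCheckMatrix_eq_submatrix`). Graphs with the same slope partition `V × V`;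
graphs with different slopes meet in exactly one point. The weights and the absence of cycles of
length four are immediate.

For the quantum parameters, let `N = |V| = p²` and let `H` be the matrix. As `N` is odd, `H Hᵀ`
over `ZMod 2` has identity blocks on the diagonal and all-one blocks off it. A vector in its kernel
is constant on each block-layer, with constants adding up to zero, and such a vector is already
killed by `Hᵀ` (`finrank_ker_graphIncidence`). Hence `H` and `H Hᵀ` have the same rank
`c = wN - (w - 1)` (`rank_graphIncidence`).

Equality of the two ranks means that the dot product is nondegenerate on the row space of `H`, so
that the space of bit strings is the direct sum of the row space and its orthogonal complement
(`exists_orthogonal_splitting`). Let `L (u, e)` be the sum of the complement vector with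
coordinates `u` and the row space vector with coordinates `e`. The unitary permuting the
computational basis by `|u⟩|e⟩ ↦ |L (u, e)⟩` sends `|u⟩|Φ⟩^{⊗ c}` to a multiple of
`∑ e, |L (u, e)⟩|e⟩`. The `Z`-checks, extended to the receiver by `e ↦ h ⬝ᵥ L (0, e)`, force a
stabilized state to be supported on the strings `(L (u, e), e)`, and the `X`-checks, extended by
the coordinates of `h`, force its amplitude there to be independent of `e`. So the encoded states
are exactly the stabilized ones (`isEACSSCode_of_splitting`), with no ancilla needed.
-/

/-! ### Entanglement-assisted codes from a nondegenerate row space -/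

open Matrix in
/-- If `H` and `H Hᵀ` have the same rank `c`, then the row space of `H` and its orthogonal
complement are complementary. In coordinates: `u ↦ L (u, 0)` parametrizes the complement,
`e ↦ L (0, e)` the row space, and `B r` is the coordinate vector of the row `H r`. -/
theorem exists_orthogonal_splitting {R A : Type*} [Fintype R] [Fintype A]
    (H : Matrix R A (ZMod 2)) {k c : ℕ} (hk : k + c = Fintype.card A) (hr : H.rank = c)
    (hg : (H * Hᵀ).rank = c) :
    ∃ (L : ((Fin k → ZMod 2) × (Fin c → ZMod 2)) ≃ₗ[ZMod 2] (A → ZMod 2))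
      (B : R → Fin c → ZMod 2),
      (∀ r, L (0, B r) = H r) ∧ (∀ r u, H r ⬝ᵥ L (u, 0) = 0) ∧
      (∀ e, (∀ r, H r ⬝ᵥ L (0, e) = 0) → e = 0) ∧
      Submodule.span (ZMod 2) (Set.range B) = ⊤ := by
  classical
  set S := Submodule.span (ZMod 2) (Set.range H) with hS
  set K := LinearMap.ker H.mulVecLin with hK
  have hSr : S = LinearMap.range Hᵀ.mulVecLin := by
    rw [Matrix.range_mulVecLin]; rfl
  have hSc : Module.finrank (ZMod 2) S = c := by
    rw [hSr, ← hr, ← Matrix.rank_transpose H]; rfl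
  have hKk : Module.finrank (ZMod 2) K = k := by
    have h := LinearMap.finrank_range_add_finrank_ker H.mulVecLin
    have h' : Module.finrank (ZMod 2) (LinearMap.range H.mulVecLin) = c := hr
    rw [h', Module.finrank_fintype_fun_eq_card, ← hK] at h
    omega
  -- `Hᵀ x` and `H Hᵀ x` vanish for the same `x`, since the two kernels have equal dimension.
  have hker : LinearMap.ker Hᵀ.mulVecLin = LinearMap.ker (H * Hᵀ).mulVecLin := by
    apply Submodule.eq_of_le_of_finrank_eq
    · rw [Matrix.mulVecLin_mul]
      exact LinearMap.ker_le_ker_comp _ _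
    · have h1 := LinearMap.finrank_range_add_finrank_ker Hᵀ.mulVecLin
      have h2 := LinearMap.finrank_range_add_finrank_ker (H * Hᵀ).mulVecLin
      have h3 : Module.finrank (ZMod 2) (LinearMap.range Hᵀ.mulVecLin) = c :=
        (Matrix.rank_transpose H).trans hr
      have h4 : Module.finrank (ZMod 2) (LinearMap.range (H * Hᵀ).mulVecLin) = c := hg
      omega
  have hdisj : Disjoint K S := by
    rw [Submodule.disjoint_def]
    intro v hv hvS
    rw [hSr] at hvS
    obtain ⟨x, rfl⟩ := hvS
    have : x ∈ LinearMap.ker (H * Hᵀ).mulVecLin := by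
      rw [Matrix.mulVecLin_mul]; exact hv
    rwa [← hker] at this
  have hcompl : IsCompl K S := by
    refine (Submodule.isCompl_iff_disjoint K S ?_).2 hdisj
    rw [hKk, hSc, Module.finrank_fintype_fun_eq_card, hk]
  let d := Module.finBasisOfFinrankEq (ZMod 2) K hKk
  let b := Module.finBasisOfFinrankEq (ZMod 2) S hSc
  let L := (d.equivFun.symm.prodCongr b.equivFun.symm).trans (K.prodEquivOfIsCompl S hcompl)
  have hL : ∀ u e, L (u, e) = (d.equivFun.symm u : A → ZMod 2) + b.equivFun.symm e :=
    fun u e => rfl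
  have hHS : ∀ r, H r ∈ S := fun r => Submodule.subset_span ⟨r, rfl⟩
  have hKr : ∀ r, ∀ v ∈ K, H r ⬝ᵥ v = 0 := fun r v hv => congrFun hv r
  refine ⟨L, fun r => b.equivFun ⟨H r, hHS r⟩, fun r => ?_, fun r u => ?_, fun e he => ?_, ?_⟩
  · simp only [hL, map_zero, LinearEquiv.symm_apply_apply, ZeroMemClass.coe_zero, zero_add]
  · rw [hL, map_zero, ZeroMemClass.coe_zero, add_zero]
    exact hKr r _ (d.equivFun.symm u).2
  · have h1 : ((b.equivFun.symm e : S) : A → ZMod 2) ∈ K := by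
      refine LinearMap.mem_ker.2 (funext fun r => ?_)
      have := he r
      rwa [hL, map_zero, ZeroMemClass.coe_zero, zero_add] at this
    have h2 := (Submodule.disjoint_def.1 hdisj) _ h1 (b.equivFun.symm e).2
    exact (LinearEquiv.map_eq_zero_iff _).1 (Subtype.ext h2)
  · have h1 : Set.range (fun r => b.equivFun ⟨H r, hHS r⟩) =
        b.equivFun '' Set.range (fun r => (⟨H r, hHS r⟩ : S)) := by
      rw [← Set.range_comp]; rfl
    rw [h1, ← LinearEquiv.coe_coe, Submodule.span_image, Submodule.map_eq_top_iff]
    apply Submodule.map_injective_of_injective S.subtype_injective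
    rw [← Submodule.span_image, ← Set.range_comp, Submodule.map_top, Submodule.range_subtype]
    rfl

/-- The code of the check operators `X^h` and `Z^h`, for the rows `h` of `H`, in coordinates as
provided by `exists_orthogonal_splitting`. -/
theorem isEACSSCode_of_splitting {R A : Type*} [Fintype A] [DecidableEq A]
    (H : Matrix R A (ZMod 2)) {k c : ℕ} (hk : k + c = Fintype.card A)
    (L : ((Fin k → ZMod 2) × (Fin c → ZMod 2)) ≃ₗ[ZMod 2] (A → ZMod 2))
    (B : R → Fin c → ZMod 2)
    (hB : ∀ r, L (0, B r) = H r) (hperp : ∀ r u, H r ⬝ᵥ L (u, 0) = 0)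
    (hnd : ∀ e, (∀ r, H r ⬝ᵥ L (0, e) = 0) → e = 0)
    (hspan : Submodule.span (ZMod 2) (Set.range B) = ⊤) :
    ∃ C, IsEACSSCode H H (Fintype.card A) k c C := by
  classical
  -- The receiver's parts of the `X`-checks are the rows `B r`; those of the `Z`-checks represent
  -- the functionals `e ↦ H r ⬝ᵥ L (0, e)`.
  set BZ : Matrix R (Fin c) (ZMod 2) := fun r i => H r ⬝ᵥ L (0, Pi.single i 1) with hBZ
  have hBZe : ∀ r e, BZ r ⬝ᵥ e = H r ⬝ᵥ L (0, e) := by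
    intro r e
    let f : (Fin c → ZMod 2) →ₗ[ZMod 2] ZMod 2 :=
      (dotProductBilin (ZMod 2) (ZMod 2) (H r)) ∘ₗ L.toLinearMap ∘ₗ LinearMap.inr _ _ _
    have h := f.pi_apply_eq_sum_univ e
    change H r ⬝ᵥ L (0, e) = _ at h
    rw [h, dotProduct]
    refine Finset.sum_congr rfl fun i _ => ?_
    rw [mul_comm, smul_eq_mul]
    congr 1
    change H r ⬝ᵥ L (0, Pi.single i 1) = H r ⬝ᵥ L (0, fun j => if i = j then 1 else 0)
    congr 3
    ext j
    simp [Pi.single_apply, eq_comm]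
  have hsplit : ∀ u e, L (u, e) = L (u, 0) + L (0, e) := by
    intro u e
    rw [← map_add]; simp
  have hHL : ∀ r u e, H r ⬝ᵥ L (u, e) = BZ r ⬝ᵥ e := by
    intro r u e
    rw [hsplit, dotProduct_add, hperp, zero_add, hBZe]
  let C : Submodule ℂ (QState (A ⊕ Fin c)) :=
    { carrier := {Ψ | (∀ r, pauliX (Sum.elim (H r) (B r)) Ψ = Ψ) ∧
        (∀ t, pauliZ (Sum.elim (H t) (BZ t)) Ψ = Ψ)}
      add_mem' := by
        rintro Ψ Ψ' ⟨h1, h2⟩ ⟨h1', h2'⟩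
        refine ⟨fun r => ?_, fun r => ?_⟩
        · conv_rhs => rw [← h1 r, ← h1' r]
          rfl
        · conv_rhs => rw [← h2 r, ← h2' r]
          ext v
          exact mul_add _ _ _
      zero_mem' := by
        refine ⟨fun r => rfl, fun r => ?_⟩
        ext v
        exact mul_zero _
      smul_mem' := by
        rintro a Ψ ⟨h1, h2⟩
        refine ⟨fun r => ?_, fun r => ?_⟩
        · conv_rhs => rw [← h1 r]
          rfl
        · conv_rhs => rw [← h2 r]
          ext v
          exact mul_left_comm _ _ _ }
  refine ⟨C, rfl, ⟨B, BZ, fun r t => ?_, fun Ψ => Iff.rfl⟩, 0, by omega, ?_⟩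
  · rw [sumElim_dotProduct_sumElim, dotProduct_comm (B r), ← hHL t 0 (B r), hB,
      dotProduct_comm (H t), CharTwo.add_self_eq_zero]
  -- The encoding permutes the computational basis, so it is unitary.
  let σ : (Fin k ⊕ (Fin 0 ⊕ Fin c) → ZMod 2) ≃ (A → ZMod 2) :=
    { toFun := fun v => L (fun t => v (Sum.inl t), fun t => v (Sum.inr (Sum.inr t)))
      invFun := fun x => Sum.elim (L.symm x).1 (Sum.elim Fin.elim0 (L.symm x).2)
      left_inv := fun v => by
        ext (i | i | i)
        · simp
        · exact i.elim0
        · simp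
      right_inv := fun x => by simp }
  have hσ1 : ∀ u e t, σ.symm (L (u, e)) (Sum.inl t) = u t := by
    intro u e t; simp [σ]
  have hσ2 : ∀ u e t, σ.symm (L (u, e)) (Sum.inr (Sum.inr t)) = e t := by
    intro u e t; simp [σ]
  refine ⟨LinearIsometryEquiv.piLpCongrLeft 2 ℂ ℂ σ, fun Ψ => ?_⟩
  have henc : ∀ ψ u e e', onSender (LinearIsometryEquiv.piLpCongrLeft 2 ℂ ℂ σ)
      (initialState 0 c ψ) (Sum.elim (L (u, e)) e') =
        if e = e' then WithLp.ofLp ψ u * ((Real.sqrt 2 : ℂ) ^ c)⁻¹ else 0 := by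
    intro ψ u e e'
    simp [onSender, initialState, LinearIsometryEquiv.piLpCongrLeft_apply,
      Equiv.piCongrLeft', hσ1, hσ2, funext_iff]
  -- Every bit string of the joint register has the form `(L (u, e), e')`.
  have hcase : ∀ P : (A ⊕ Fin c → ZMod 2) → Prop,
      (∀ u e e', P (Sum.elim (L (u, e)) e')) → ∀ v, P v := by
    intro P hP v
    have := hP (L.symm (v ∘ Sum.inl)).1 (L.symm (v ∘ Sum.inl)).2 (v ∘ Sum.inr)
    rwa [Prod.mk.eta, LinearEquiv.apply_symm_apply, Sum.elim_comp_inl_inr] at this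
  have hX : ∀ r u e e' (Ψ : QState (A ⊕ Fin c)),
      pauliX (Sum.elim (H r) (B r)) Ψ (Sum.elim (L (u, e)) e') =
        Ψ (Sum.elim (L (u, e - B r)) (e' - B r)) := by
    intro r u e e' Ψ
    have h1 : L (u, e - B r) = L (u, e) - H r := by
      rw [← hB r, ← map_sub, Prod.mk_sub_mk, sub_zero]
    rw [h1]
    refine congrArg Ψ.ofLp ?_
    ext (i | i) <;> rfl
  have hZ : ∀ r u e e' (Ψ : QState (A ⊕ Fin c)),
      pauliZ (Sum.elim (H r) (BZ r)) Ψ (Sum.elim (L (u, e)) e') =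
        (-1) ^ (H r ⬝ᵥ L (0, e - e')).val * Ψ (Sum.elim (L (u, e)) e') := by
    intro r u e e' Ψ
    change (-1 : ℂ) ^ (Sum.elim (H r) (BZ r) ⬝ᵥ Sum.elim (L (u, e)) e').val * _ = _
    rw [sumElim_dotProduct_sumElim, hHL, hHL, dotProduct_sub, CharTwo.sub_eq_add]
  constructor
  · rintro ⟨h1, h2⟩
    -- If `e ≠ e'`, some `Z`-check negates the amplitude at `(L (u, e), e')`.
    have hoff : ∀ u e e', e ≠ e' → Ψ (Sum.elim (L (u, e)) e') = 0 := by
      intro u e e' hne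
      obtain ⟨r, hr⟩ := not_forall.1 fun h => hne (sub_eq_zero.1 (hnd (e - e') h))
      have h := congrArg (fun Φ : QState (A ⊕ Fin c) => Φ (Sum.elim (L (u, e)) e')) (h2 r)
      simp only [hZ] at h
      rw [Fin.eq_one_of_ne_zero _ hr] at h
      change (-1 : ℂ) ^ 1 * _ = _ at h
      linear_combination (-1 / 2 : ℂ) * h
    -- The `X`-checks translate `e` by the vectors `B r`, which span everything.
    have hdiag : ∀ g u e, Ψ (Sum.elim (L (u, e - g)) (e - g)) = Ψ (Sum.elim (L (u, e)) e) := by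
      intro g
      have hg : g ∈ Submodule.span (ZMod 2) (Set.range B) := hspan ▸ Submodule.mem_top
      induction hg using Submodule.span_induction with
      | mem x hx =>
        obtain ⟨r, rfl⟩ := hx
        intro u e
        rw [← hX, h1 r]
      | zero => simp
      | add x y _ _ hx hy =>
        intro u e
        rw [← sub_sub, hy, hx]
      | smul a x _ hx =>
        intro u e
        obtain rfl | rfl : a = 0 ∨ a = 1 := by decide +revert
        · simp
        · rw [one_smul, hx]
    refine ⟨WithLp.toLp 2 fun u => (Real.sqrt 2 : ℂ) ^ c * Ψ (Sum.elim (L (u, 0)) 0), ?_⟩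
    ext v
    induction v using hcase with | _ u e e'
    rw [henc]
    split_ifs with h
    · subst h
      have h0 := hdiag e u e
      rw [sub_self] at h0
      rw [← h0]
      have : (Real.sqrt 2 : ℂ) ≠ 0 := by simp
      field_simp
    · exact (hoff u e e' h).symm
  · rintro ⟨ψ, rfl⟩
    refine ⟨fun r => ?_, fun r => ?_⟩
    · ext v
      induction v using hcase with | _ u e e'
      rw [hX, henc, henc]
      simp only [sub_left_inj]
    · ext v
      induction v using hcase with | _ u e e'
      rw [hZ, henc]
      split_ifs with h
      · subst h
        rw [sub_self, Prod.mk_zero_zero, map_zero, dotProduct_zero]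
        simp
      · rw [mul_zero]

/-! ### Cycles of length four in Tanner graphs -/

theorem tannerGraph_adj_inl_inr {R A : Type*} {H : Matrix R A (ZMod 2)} {r : R} {a : A} :
    (tannerGraph H).Adj (Sum.inl r) (Sum.inr a) ↔ H r a ≠ 0 := by
  simp [tannerGraph]

theorem not_tannerGraph_adj_inl_inl {R A : Type*} {H : Matrix R A (ZMod 2)} {r r' : R} :
    ¬ (tannerGraph H).Adj (Sum.inl r) (Sum.inl r') := by
  simp [tannerGraph]

theorem not_tannerGraph_adj_inr_inr {R A : Type*} {H : Matrix R A (ZMod 2)} {a a' : A} :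
    ¬ (tannerGraph H).Adj (Sum.inr a) (Sum.inr a') := by
  simp [tannerGraph]

theorem tannerGraph_cycle_length_ne_four {R A : Type*} {H : Matrix R A (ZMod 2)}
    (hH : ∀ r r' a a', H r a ≠ 0 → H r a' ≠ 0 → H r' a ≠ 0 → H r' a' ≠ 0 → r = r' ∨ a = a')
    (v : R ⊕ A) (q : (tannerGraph H).Walk v v) (hq : q.IsCycle) : q.length ≠ 4 := by
  intro h4
  have hinj := hq.getVert_injOn
  have key : ∀ a b c d, (tannerGraph H).Adj a b → (tannerGraph H).Adj b c →
      (tannerGraph H).Adj c d → (tannerGraph H).Adj d a → a = c ∨ b = d := by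
    intro a b c d hab hbc hcd hda
    rcases a with r | x <;> rcases b with s | y
    · exact absurd hab not_tannerGraph_adj_inl_inl
    · rcases c with r' | z
      · rcases d with s' | y'
        · exact absurd hcd not_tannerGraph_adj_inl_inl
        · simpa using hH r r' y y' (tannerGraph_adj_inl_inr.1 hab)
            (tannerGraph_adj_inl_inr.1 hda.symm) (tannerGraph_adj_inl_inr.1 hbc.symm)
            (tannerGraph_adj_inl_inr.1 hcd)
      · exact absurd hbc not_tannerGraph_adj_inr_inr
    · rcases c with r' | z
      · exact absurd hbc not_tannerGraph_adj_inl_inl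
      · rcases d with s' | y'
        · simpa [or_comm] using hH s s' x z (tannerGraph_adj_inl_inr.1 hab.symm)
            (tannerGraph_adj_inl_inr.1 hbc) (tannerGraph_adj_inl_inr.1 hda)
            (tannerGraph_adj_inl_inr.1 hcd.symm)
        · exact absurd hcd not_tannerGraph_adj_inr_inr
    · exact absurd hab not_tannerGraph_adj_inr_inr
  have h40 : q.getVert 4 = q.getVert 0 := by
    rw [← h4, q.getVert_length, q.getVert_zero]
  have adj : ∀ i < 4, (tannerGraph H).Adj (q.getVert i) (q.getVert (i + 1)) := fun i hi =>
    q.adj_getVert_succ (h4 ▸ hi)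
  rcases key _ _ _ _ (adj 0 (by norm_num)) (adj 1 (by norm_num)) (adj 2 (by norm_num))
    (h40 ▸ adj 3 (by norm_num)) with h | h
  · rw [← h40] at h
    exact absurd (hinj ⟨by norm_num, h4.ge⟩ ⟨by norm_num, by omega⟩ h) (by norm_num)
  · exact absurd (hinj ⟨le_rfl, by omega⟩ ⟨by norm_num, by omega⟩ h) (by norm_num)

/-! ### Incidence of points with graphs of affine maps -/

section graphIncidence

variable {ι F V : Type*} [Field F] [AddCommGroup V] [Module F V] [DecidableEq V]

/-- The incidence matrix between graphs of affine maps and points of `V × V`: the row `(m, s)`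
stands for the graph of `x ↦ s + μ m • x`. -/
def graphIncidence (V : Type*) [AddCommGroup V] [Module F V] [DecidableEq V] (μ : ι → F) :
    Matrix (ι × V) (V × V) (ZMod 2) :=
  fun r a => if a.2 = r.2 + μ r.1 • a.1 then 1 else 0

theorem graphIncidence_ne_zero_iff {μ : ι → F} {r : ι × V} {a : V × V} :
    graphIncidence V μ r a ≠ 0 ↔ a.2 = r.2 + μ r.1 • a.1 := by
  unfold graphIncidence
  split_ifs with h <;> simp [h]

/-- A graph has one point over each element of `V`, and exactly one graph of each slope passes
through a given point. -/
theorem graphIncidence_hasWeights (μ : ι → F) :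
    HasWeights (graphIncidence V μ) (Nat.card V) (Nat.card ι) := by
  refine ⟨fun r => ?_, fun a => ?_⟩
  · simp only [graphIncidence_ne_zero_iff]
    have : {a : V × V | a.2 = r.2 + μ r.1 • a.1} =
        Set.range fun x : V => (x, r.2 + μ r.1 • x) := by
      ext ⟨x, y⟩; simp [eq_comm]
    rw [this, Set.ncard_range_of_injective fun x y h => congrArg Prod.fst h]
  · simp only [graphIncidence_ne_zero_iff]
    have : {r : ι × V | a.2 = r.2 + μ r.1 • a.1} =
        Set.range fun m : ι => (m, a.2 - μ m • a.1) := by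
      ext ⟨m, s⟩; simp [sub_eq_iff_eq_add]
    rw [this, Set.ncard_range_of_injective fun x y h => congrArg Prod.fst h]

/-- Two distinct graphs have at most one point in common. -/
theorem graphIncidence_common {μ : ι → F} (hμ : Function.Injective μ) (r r' : ι × V)
    (a a' : V × V) (h1 : graphIncidence V μ r a ≠ 0) (h2 : graphIncidence V μ r a' ≠ 0)
    (h3 : graphIncidence V μ r' a ≠ 0) (h4 : graphIncidence V μ r' a' ≠ 0) :
    r = r' ∨ a = a' := by
  rw [graphIncidence_ne_zero_iff] at h1 h2 h3 h4
  obtain ⟨m, s⟩ := r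
  obtain ⟨m', s'⟩ := r'
  obtain ⟨x, y⟩ := a
  obtain ⟨x', y'⟩ := a'
  simp only at h1 h2 h3 h4
  by_cases hm : m = m'
  · subst hm
    left
    rw [h1] at h3
    rw [add_right_cancel h3]
  · right
    have h : (μ m - μ m') • (x - x') = 0 := by
      have e1 : μ m • x - μ m • x' = y - y' := by rw [h1, h2]; abel
      have e2 : μ m' • x - μ m' • x' = y - y' := by rw [h3, h4]; abel
      rw [sub_smul, smul_sub, smul_sub, e1, e2, sub_self]
    have hx : x = x' := by
      rcases smul_eq_zero.1 h with h | h
      · exact absurd (hμ (sub_eq_zero.1 h)) hm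
      · exact sub_eq_zero.1 h
    subst hx
    rw [h1, h2]

variable [Fintype V]

open Matrix in
/-- Two graphs of the same slope are equal, with an odd number of points, or disjoint; graphs of
different slopes meet in one point. -/
theorem graphIncidence_mul_transpose_apply [DecidableEq ι] {μ : ι → F}
    (hμ : Function.Injective μ) (hV : Odd (Fintype.card V)) (r r' : ι × V) :
    (graphIncidence V μ * (graphIncidence V μ)ᵀ) r r' =
      (if r = r' then 1 else 0) + (if r.1 = r'.1 then 0 else 1) := by
  obtain ⟨m, s⟩ := r
  obtain ⟨m', s'⟩ := r'
  have h : (graphIncidence V μ * (graphIncidence V μ)ᵀ) (m, s) (m', s') =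
      ∑ x : V, if s' + μ m' • x = s + μ m • x then 1 else 0 := by
    rw [Matrix.mul_apply, Fintype.sum_prod_type]
    simp [graphIncidence]
  rw [h]
  by_cases hm : m = m'
  · subst hm
    by_cases hs : s = s' <;> simp [hs, eq_comm (a := s'), (ZMod.natCast_eq_one_iff_odd).2 hV]
  · have hm' : μ m - μ m' ≠ 0 := sub_ne_zero.2 fun h => hm (hμ h)
    have : ∀ x : V, s' + μ m' • x = s + μ m • x ↔ x = (μ m - μ m')⁻¹ • (s' - s) := by
      intro x
      rw [eq_inv_smul_iff₀ hm', sub_smul, sub_eq_sub_iff_add_eq_add, add_comm s,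
        eq_comm]
    simp [this, hm]

variable [Fintype ι]

open Matrix in
/-- Both kernels consist of the vectors that depend on the slope only, with values adding up to
zero. -/
theorem finrank_ker_graphIncidence [Nonempty ι] {μ : ι → F}
    (hμ : Function.Injective μ) (hV : Odd (Fintype.card V)) :
    Module.finrank (ZMod 2) (LinearMap.ker (graphIncidence V μ)ᵀ.mulVecLin) + 1 = Fintype.card ι ∧
    LinearMap.ker (graphIncidence V μ * (graphIncidence V μ)ᵀ).mulVecLin =
      LinearMap.ker (graphIncidence V μ)ᵀ.mulVecLin := by
  classical
  let total : (ι → ZMod 2) →ₗ[ZMod 2] ZMod 2 := Fintype.linearCombination (ZMod 2) (fun _ => 1)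
  have htotal : ∀ γ, total γ = ∑ m, γ m := fun γ => by
    simp [total, Fintype.linearCombination_apply]
  let lift : (ι → ZMod 2) →ₗ[ZMod 2] (ι × V → ZMod 2) := LinearMap.funLeft _ _ Prod.fst
  have hVcard : (Fintype.card V : ZMod 2) = 1 := (ZMod.natCast_eq_one_iff_odd).2 hV
  -- Each point lies on one graph of each slope, so `Hᵀ` sums up the values of the slopes.
  have h1 : (LinearMap.ker total).map lift ≤ LinearMap.ker (graphIncidence V μ)ᵀ.mulVecLin := by
    rintro _ ⟨γ, hγ, rfl⟩
    have hγ' : ∑ m, γ m = 0 := (htotal γ).symm.trans hγ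
    refine LinearMap.mem_ker.2 (funext fun a => ?_)
    have : ∀ (m : ι) (s : V), a.2 = s + μ m • a.1 ↔ s = a.2 - μ m • a.1 := fun m s => by
      rw [eq_sub_iff_add_eq, eq_comm]
    simp only [Matrix.mulVecLin_apply, Matrix.mulVec, dotProduct, Matrix.transpose_apply,
      Fintype.sum_prod_type, graphIncidence, lift, LinearMap.funLeft_apply, this, ite_mul, one_mul,
      zero_mul, Finset.sum_ite_eq', Finset.mem_univ, if_true, hγ', Pi.zero_apply]
  have h2 : LinearMap.ker (graphIncidence V μ)ᵀ.mulVecLin ≤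
      LinearMap.ker (graphIncidence V μ * (graphIncidence V μ)ᵀ).mulVecLin := by
    rw [Matrix.mulVecLin_mul]
    exact LinearMap.ker_le_ker_comp _ _
  have h3 : LinearMap.ker (graphIncidence V μ * (graphIncidence V μ)ᵀ).mulVecLin ≤
      (LinearMap.ker total).map lift := by
    intro x hx
    -- The off-diagonal blocks contribute the sum over all other slopes, which in characteristic
    -- two is the total plus the sum over the slope itself.
    have hx' : ∀ m s, x (m, s) = ∑ m' , ∑ s', x (m', s') + ∑ s', x (m, s') := by
      intro m s
      have h := congrFun (LinearMap.mem_ker.1 hx) (m, s)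
      simp only [Matrix.mulVecLin_apply, Matrix.mulVec, dotProduct,
        graphIncidence_mul_transpose_apply hμ hV, add_mul, Finset.sum_add_distrib,
        ite_mul, one_mul, zero_mul, Finset.sum_ite_eq, Finset.mem_univ, if_true,
        Pi.zero_apply] at h
      rw [CharTwo.add_eq_zero.1 h, Fintype.sum_prod_type]
      have : ∀ m', (∑ s', if m = m' then 0 else x (m', s')) =
          ∑ s', x (m', s') + if m = m' then ∑ s', x (m', s') else 0 := by
        intro m'; split_ifs <;> simp [CharTwo.add_self_eq_zero]
      simp only [this, Finset.sum_add_distrib, Finset.sum_ite_eq, Finset.mem_univ, if_true]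
    have hV0 : Nonempty V := ⟨0⟩
    have hx0 : ∀ m s, x (m, s) = x (m, 0) := fun m s => by rw [hx' m s, hx' m 0]
    -- As `|V|` is odd, the sum over a slope equals its constant value, so the total must vanish.
    have hσ : ∀ m, ∑ s', x (m, s') = x (m, 0) := fun m => by
      simp [hx0 m, hVcard]
    refine ⟨fun m => x (m, 0), ?_, funext fun r => (hx0 r.1 r.2).symm⟩
    refine LinearMap.mem_ker.2 ?_
    rw [htotal]
    have m := Classical.arbitrary ι
    have h := hx' m 0
    simp only [hσ] at h
    exact right_eq_add.1 h
  have h4 : (LinearMap.ker total).map lift = LinearMap.ker (graphIncidence V μ)ᵀ.mulVecLin :=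
    le_antisymm h1 (h2.trans h3)
  refine ⟨?_, le_antisymm (h3.trans h1) h2⟩
  have hinj : Function.Injective lift :=
    LinearMap.funLeft_injective_of_surjective _ _ _ Prod.fst_surjective
  rw [← h4, (Submodule.equivMapOfInjective lift hinj _).symm.finrank_eq]
  have h5 := LinearMap.finrank_range_add_finrank_ker total
  have h6 : LinearMap.range total = ⊤ := by
    refine LinearMap.range_eq_top.2 fun z => ⟨Pi.single (Classical.arbitrary ι) z, ?_⟩
    rw [htotal, Finset.sum_pi_single']; simp
  rw [h6, finrank_top, Module.finrank_self, Module.finrank_fintype_fun_eq_card] at h5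
  omega

end graphIncidence

open Matrix in
theorem rank_graphIncidence {ι F V : Type*} [Field F] [AddCommGroup V] [Module F V]
    [DecidableEq V] [Fintype V] [Fintype ι] [Nonempty ι] {μ : ι → F}
    (hμ : Function.Injective μ) (hV : Odd (Fintype.card V)) :
    (graphIncidence V μ).rank = Fintype.card V + (Fintype.card ι - 1) * (Fintype.card V - 1) ∧
      (graphIncidence V μ * (graphIncidence V μ)ᵀ).rank =
        Fintype.card V + (Fintype.card ι - 1) * (Fintype.card V - 1) := by
  obtain ⟨h1, h2⟩ := finrank_ker_graphIncidence hμ hV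
  have h3 := LinearMap.finrank_range_add_finrank_ker (graphIncidence V μ)ᵀ.mulVecLin
  have h4 := LinearMap.finrank_range_add_finrank_ker
    (graphIncidence V μ * (graphIncidence V μ)ᵀ).mulVecLin
  rw [Module.finrank_fintype_fun_eq_card, Fintype.card_prod] at h3 h4
  rw [h2] at h4
  rw [← Matrix.rank_transpose (graphIncidence V μ), Matrix.rank, Matrix.rank]
  obtain ⟨n, hn⟩ := Nat.exists_eq_succ_of_ne_zero hV.pos.ne'
  have h5 : Fintype.card ι * Fintype.card V =
      Fintype.card V + (Fintype.card ι - 1) * (Fintype.card V - 1) + (Fintype.card ι - 1) := by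
    rw [← h1, hn]
    simp only [Nat.add_sub_cancel, Nat.succ_eq_add_one]
    ring
  omega

/-! ### Coordinates for layers and positions -/

theorem iterate_shiftX {p : ℕ} (n : ℕ) (T : ZMod p → ZMod p → ZMod p → ZMod 2) (x y z : ZMod p) :
    shiftX^[n] T x y z = T (x - n) y z := by
  induction n generalizing x with
  | zero => simp
  | succ n ih =>
    rw [Function.iterate_succ_apply', shiftX, ih]
    push_cast
    congr 1
    ring

theorem iterate_shiftY {p : ℕ} (n : ℕ) (T : ZMod p → ZMod p → ZMod p → ZMod 2) (x y z : ZMod p) :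
    shiftY^[n] T x y z = T x (y - n) z := by
  induction n generalizing y with
  | zero => simp
  | succ n ih =>
    rw [Function.iterate_succ_apply', shiftY, ih]
    push_cast
    congr 1
    ring

theorem tile_apply {p : ℕ} [NeZero p] (φ ψ : Equiv.Perm (ZMod p)) (ζ : ℕ → Equiv.Perm (ZMod p))
    (i j k : ℕ) (x y z : ZMod p) :
    tile φ ψ ζ i j k x y z =
      if y = z + ((k / p : ℕ) : ZMod p) * φ i ∧
        x - y = etaMap ζ k + ((k / p : ℕ) : ZMod p) * ψ j then 1 else 0 := by
  rw [tile, iterate_shiftX, iterate_shiftY, ZMod.natCast_zmod_val, ZMod.natCast_zmod_val,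
    identityTensor]
  refine if_congr ?_ rfl rfl
  rw [tileShiftX, tileShiftY]
  constructor
  · rintro ⟨h1, h2⟩
    exact ⟨by linear_combination h2, by linear_combination h1⟩
  · rintro ⟨h1, h2⟩
    exact ⟨by linear_combination h2, by linear_combination h1⟩

theorem Nat.eq_of_div_eq_of_cast_zmod_eq {p a b : ℕ} (h : a / p = b / p)
    (h' : (a : ZMod p) = (b : ZMod p)) : a = b := by
  rw [ZMod.natCast_eq_natCast_iff'] at h'
  rw [← Nat.div_add_mod a p, ← Nat.div_add_mod b p, h, h']

section coordinates

variable {p : ℕ} [NeZero p]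

/-- The coordinates of a selected layer: its block-layer `m`, and the vector made of its local
height `z` in the tile and of the value `η(k)` at the height `k` of the tile. -/
def layerCoordinates (ζ : ℕ → Equiv.Perm (ZMod p)) (W : Finset (Fin p)) (l : SelectedLayer W) :
    W × (ZMod p × ZMod p) :=
  (⟨⟨l.val.val / p ^ 2, by
      obtain ⟨m, -, hm⟩ := l.2
      exact hm ▸ m.2⟩, by
      obtain ⟨m, hm, h⟩ := l.2
      simpa only [h] using hm⟩,
    ((l.val.val : ZMod p), etaMap ζ (l.val.val / p)))

theorem layerCoordinates_bijective (ζ : ℕ → Equiv.Perm (ZMod p)) (W : Finset (Fin p)) :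
    Function.Bijective (layerCoordinates ζ W) := by
  have hp : 0 < p := NeZero.pos p
  constructor
  · intro l l' h
    simp only [layerCoordinates, Prod.mk.injEq, Subtype.mk.injEq, Fin.mk.injEq] at h
    obtain ⟨h1, h2, h3⟩ := h
    have hsq : ∀ n, n / p ^ 2 = n / p / p := fun n => by rw [pow_two, Nat.div_div_eq_div_mul]
    rw [hsq, hsq] at h1
    rw [etaMap, etaMap, h1] at h3
    exact Subtype.ext (Fin.ext (Nat.eq_of_div_eq_of_cast_zmod_eq
      (Nat.eq_of_div_eq_of_cast_zmod_eq h1 ((ζ _).injective h3)) h2))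
  · rintro ⟨⟨m, hm⟩, z, s⟩
    set r := (ζ m.val).symm s with hr
    have h1 : (z.val + p * (r.val + p * m.val)) / p = r.val + p * m.val := by
      rw [Nat.add_mul_div_left _ _ hp, Nat.div_eq_of_lt z.val_lt, zero_add]
    have h2 : (r.val + p * m.val) / p = m.val := by
      rw [Nat.add_mul_div_left _ _ hp, Nat.div_eq_of_lt r.val_lt, zero_add]
    have h3 : (z.val + p * (r.val + p * m.val)) / p ^ 2 = m.val := by
      rw [pow_two, ← Nat.div_div_eq_div_mul, h1, h2]
    have h4 : z.val + p * (r.val + p * m.val) < p ^ 3 := by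
      rw [pow_succ', ← Nat.div_lt_iff_lt_mul (by positivity), h3]
      exact m.2
    refine ⟨⟨⟨_, h4⟩, m, hm, h3⟩, ?_⟩
    simp only [layerCoordinates, h1, h3, etaMap, h2, Prod.mk.injEq]
    refine ⟨trivial, by simp, ?_⟩
    simp [hr]

/-- The coordinates of a position `(x, y)` of the array: the values of `φ` and `ψ` at the tile
indices, and the vector `(y, x - y)` made of the coordinates modulo `p`. The second component is
chosen so that the `X`-shift `η(k) + m (φ(i) + ψ(j))` and the `Y`-shift `m φ(i)` differ by
`η(k) + m ψ(j)`. -/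
def positionCoordinates (φ ψ : Equiv.Perm (ZMod p)) (q : Fin (p ^ 2) × Fin (p ^ 2)) :
    (ZMod p × ZMod p) × (ZMod p × ZMod p) :=
  ((φ ((q.1.val / p : ℕ) : ZMod p), ψ ((q.2.val / p : ℕ) : ZMod p)),
    ((q.2.val : ZMod p), (q.1.val : ZMod p) - (q.2.val : ZMod p)))

theorem positionCoordinates_bijective (φ ψ : Equiv.Perm (ZMod p)) :
    Function.Bijective (positionCoordinates φ ψ) := by
  rw [Fintype.bijective_iff_injective_and_card]
  constructor
  · rintro ⟨x, y⟩ ⟨x', y'⟩ h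
    simp only [positionCoordinates, Prod.mk.injEq, EmbeddingLike.apply_eq_iff_eq] at h
    obtain ⟨⟨h1, h2⟩, h3, h4⟩ := h
    rw [h3, sub_left_inj] at h4
    have key : ∀ a b : Fin (p ^ 2), ((a.val / p : ℕ) : ZMod p) = ((b.val / p : ℕ) : ZMod p) →
        (a.val : ZMod p) = b.val → a = b := by
      intro a b hab hab'
      refine Fin.ext (Nat.eq_of_div_eq_of_cast_zmod_eq ?_ hab')
      have hlt : ∀ a : Fin (p ^ 2), a.val / p < p := fun a =>
        Nat.div_lt_of_lt_mul (pow_two p ▸ a.2)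
      rwa [ZMod.natCast_eq_natCast_iff', Nat.mod_eq_of_lt (hlt a), Nat.mod_eq_of_lt (hlt b)] at hab
    rw [key x x' h1 h4, key y y' h2 h3]
  · simp only [Fintype.card_prod, Fintype.card_fin, ZMod.card]
    ring

end coordinates

theorem parityCheckMatrix_eq_submatrix {p : ℕ} [Fact p.Prime] (φ ψ : Equiv.Perm (ZMod p))
    (ζ : ℕ → Equiv.Perm (ZMod p)) (W : Finset (Fin p)) :
    parityCheckMatrix φ ψ ζ W =
      (graphIncidence (ZMod p × ZMod p) fun m : W => (m.val.val : ZMod p)).submatrix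
        (layerCoordinates ζ W) (positionCoordinates φ ψ) := by
  ext l q
  rw [parityCheckMatrix, parityCheckTensor, tile_apply]
  simp only [Matrix.submatrix_apply, graphIncidence]
  refine if_congr ?_ rfl rfl
  rw [Nat.div_div_eq_div_mul, ← pow_two, Prod.ext_iff]
  rfl

/-! ### The parameters of the code -/

theorem HasWeights.submatrix {R A R' A' : Type*} {H : Matrix R A (ZMod 2)} {a b : ℕ}
    (h : HasWeights H a b) (f : R' ≃ R) (g : A' ≃ A) : HasWeights (H.submatrix f g) a b := by
  refine ⟨fun r => ?_, fun x => ?_⟩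
  · rw [← h.1 (f r), ← Set.ncard_preimage_of_injective_subset_range g.injective (by simp)]
    rfl
  · rw [← h.2 (g x), ← Set.ncard_preimage_of_injective_subset_range f.injective (by simp)]
    rfl

theorem mainTheorem7 (p : ℕ) (hp : p.Prime) (hp2 : 2 < p)
    (φ ψ : Equiv.Perm (ZMod p)) (ζ : ℕ → Equiv.Perm (ZMod p))
    (w : ℕ) (hw : 1 ≤ w) (W : Finset (Fin p)) (hW : W.card = w) :
    (∃ C : Submodule ℂ (QState ((Fin (p ^ 2) × Fin (p ^ 2)) ⊕
        Fin (p ^ 2 + (w - 1) * (p ^ 2 - 1)))),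
      IsEACSSCode (parityCheckMatrix φ ψ ζ W) (parityCheckMatrix φ ψ ζ W)
        (p ^ 4) ((p ^ 2 - 1) * (p ^ 2 - w + 1)) (p ^ 2 + (w - 1) * (p ^ 2 - 1)) C) ∧
    HasWeights (parityCheckMatrix φ ψ ζ W) (p ^ 2) w ∧
    (∀ (v : SelectedLayer W ⊕ (Fin (p ^ 2) × Fin (p ^ 2)))
      (q : (tannerGraph (parityCheckMatrix φ ψ ζ W)).Walk v v), q.IsCycle → q.length ≠ 4) := by
  have : Fact p.Prime := ⟨hp⟩
  subst hW
  have : Nonempty W := (Finset.card_pos.1 hw).to_subtype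
  set V := ZMod p × ZMod p
  set μ : W → ZMod p := fun m => (m.val.val : ZMod p) with hμdef
  -- The block-layers are numbered below `p`, so they stay distinct modulo `p`.
  have hμ : Function.Injective μ := by
    intro m m' h
    rw [hμdef, ZMod.natCast_eq_natCast_iff', Nat.mod_eq_of_lt m.val.2,
      Nat.mod_eq_of_lt m'.val.2] at h
    exact Subtype.ext (Fin.ext h)
  have hVcard : Fintype.card V = p ^ 2 := by
    simp only [V, Fintype.card_prod, ZMod.card]
    ring
  have hodd : Odd (Fintype.card V) := hVcard ▸ (hp.odd_of_ne_two hp2.ne').pow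
  let f := Equiv.ofBijective _ (layerCoordinates_bijective ζ W)
  let g := Equiv.ofBijective _ (positionCoordinates_bijective φ ψ)
  have hH : parityCheckMatrix φ ψ ζ W = (graphIncidence V μ).submatrix f g :=
    parityCheckMatrix_eq_submatrix φ ψ ζ W
  have hrank := rank_graphIncidence hμ hodd
  rw [hVcard, Fintype.card_coe] at hrank
  rw [hH]
  refine ⟨?_, ?_, tannerGraph_cycle_length_ne_four fun r r' a a' h1 h2 h3 h4 =>
    (graphIncidence_common hμ _ _ _ _ h1 h2 h3 h4).imp (f.injective ·) (g.injective ·)⟩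
  · have hr : ((graphIncidence V μ).submatrix f g).rank = p ^ 2 + (W.card - 1) * (p ^ 2 - 1) := by
      rw [Matrix.rank_submatrix, hrank.1]
    have hg : ((graphIncidence V μ).submatrix f g *
        ((graphIncidence V μ).submatrix f g).transpose).rank =
          p ^ 2 + (W.card - 1) * (p ^ 2 - 1) := by
      rw [Matrix.transpose_submatrix, Matrix.submatrix_mul_equiv, Matrix.rank_submatrix, hrank.2]
    have hcard : Fintype.card (Fin (p ^ 2) × Fin (p ^ 2)) = p ^ 4 := by
      rw [Fintype.card_prod, Fintype.card_fin]
      ring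
    have hk : (p ^ 2 - 1) * (p ^ 2 - W.card + 1) + (p ^ 2 + (W.card - 1) * (p ^ 2 - 1)) =
        Fintype.card (Fin (p ^ 2) × Fin (p ^ 2)) := by
      have h1 : W.card ≤ p ^ 2 :=
        (W.card_le_univ.trans_eq (Fintype.card_fin p)).trans (Nat.le_self_pow two_ne_zero p)
      have h2 : 1 ≤ p ^ 2 := hw.trans h1
      rw [hcard]
      zify [hw, h1, h2]
      ring
    obtain ⟨L, B, hB, hperp, hnd, hspan⟩ := exists_orthogonal_splitting _ hk hr hg
    rw [← hcard]
    exact isEACSSCode_of_splitting _ hk L B hB hperp hnd hspan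
  · have h := (graphIncidence_hasWeights (V := V) μ).submatrix f g
    rwa [Nat.card_eq_fintype_card, hVcard, Nat.card_eq_fintype_card, Fintype.card_coe] at h
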